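/- **Setting.** A transmitter with an energy-harvesting battery operates in slots $t=0,1,2,\dots$ of duration $\Delta t>0$. The battery limits are $E_{\min}\le E_{\max}$, the maximum energy charged per slot is $E_{c,\max}\ge 0$ and the maximum transmit power is $P_{\max}>0$, with $E_{c,\max}\le \Delta tP_{\max}\le E_{\max}-E_{\min}$. The system states $(E_a(t),\gamma(t))$ (energy arrival and normalized channel gain, with values in $[0,\infty)^2$) are i.i.d. over $t$ with an arbitrary joint distribution; in particular $\gamma(t)$ may be unbounded. From a given level $E_b(0)\in[E_{\min},E_{\max}]$, if power $P(t)$ is used in slot $t$, the battery level evolves as $$E_b(t+1)=E_b(t)-\Delta tP(t)+E_s(t),\qquad E_s(t)=\min\{E_{\max}-(E_b(t)-\Delta tP(t)),\,E_a(t),\,E_{c,\max}\}.$$ **P1.** A policy is feasible if $P(t)$ is determined by the information available in slot $t$ (which includes the system states up to slot $t$), $0\le P(t)\le P_{\max}$ and $\Delta tP(t)\le E_b(t)-E_{\min}$ for all $t$, almost surely. Problem P1 is to maximize the long-term time average of the expected rate $\mathbb E[R(t)]$, $R(t)=\log(1+P(t)\gamma(t))$; its optimal value is $$\bar R^{\rm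 opt}=\sup_{\{P(t)\}\ \text{feasible}}\ \limsup_{T\to\infty}\frac1T\sum_{t=0}^{T-1}\mathbb E[R(t)].$$ **Algorithm 2.** Let $\gamma_{\max}>0$, let $\eta=\mathrm{Prob}(\gamma(t)>\gamma_{\max})$ be the outage probability, $\zeta_{\max}=\gamma_{\max}/\Delta t$, and let $0<V\le V_{\max}=(E_{\max}-E_{\min}-E_{c,\max}-\Delta tP_{\max})/\zeta_{\max}$. Put $$E_{1}(t)=\Delta tP_{\max}+E_{\min}+V\Big(\zeta_{\max}-\frac{\gamma(t)}{\Delta t}\Big),\qquad E_{2}(t)=\Delta tP_{\max}+E_{\min}+V\Big(\zeta_{\max}-\frac{\gamma(t)}{\Delta t(P_{\max}\gamma(t)+1)}\Big),$$ and let $P^*(t)=0$ if $E_b(t)<E_{1}(t)$, $P^*(t)=P_{\max}$ if $E_b(t)>E_{2}(t)$, and $$P^*(t)=\frac{V}{\Delta t\,(V\zeta_{\max}+\Delta tP_{\max}+E_{\min}-E_b(t))}-\frac1{\gamma(t)}$$ otherwise (with $P^*(t)=0$ in the degenerate case $\gamma(t)=0$, $E_b(t)=E_1(t)=E_2(t)$).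 The algorithm uses $P^s(t)=P^*(t)$, except that if $\gamma(t)>\gamma_{\max}$ and $P^*(t)>(E_b(t)-E_{\min})/\Delta t$ it uses $$P^s(t)=\max\Big\{\frac{E_b(t)-\bar E^e_b(t-1)}{\Delta t},\,0\Big\},\qquad \bar E^e_b(t)=\frac1t\sum_{\tau=1}^{t}\big(E_b(\tau)-\Delta tP^s(\tau)\big),$$ where an arbitrary fixed value in $[E_{\min},E_{\max}]$ is used in place of $\bar E_b^e(t-1)$ for $t\le1$, when that average does not exist. Its long-term average rate is $\bar R^s(V,\eta)=\liminf_{T\to\infty}\frac1T\sum_{t=0}^{T-1}\mathbb E[\log(1+P^s(t)\gamma(t))]$. **Theorem 2.** Let $B=\max\{E_{c,\max},\Delta tP_{\max}\}^2/2$ and $G=\mathbb E[\log(1+P_{\max}\gamma(t))\mid\gamma(t)>\gamma_{\max}]$ (with $\eta G=0$ if $\eta=0$). Then $$\bar R^{\rm opt}-\bar R^s(V,\eta)\le(1-\eta)\frac BV+\eta G,$$ that is, $\bar R^{\rm opt}\le\bar R^s(V,\eta)+(1-\eta)\frac BV+\eta G$ in $[0,\infty]$. Moreover $G>0$ if $\eta>0$,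 and $G<\infty$ if $\eta>0$ and $\mathbb E[\log(1+P_{\max}\gamma(t))]<\infty$. -/

import Mathlib

open MeasureTheory ProbabilityTheory Filter

noncomputable section

/-- Physical constants of the transmitter: slot duration `Δt`, battery limits `Emin`, `Emax`,
maximum energy charged per slot `Ecmax`, maximum transmit power `Pmax`. -/
structure TxSystem where
  Δt : ℝ
  Emin : ℝ
  Emax : ℝ
  Ecmax : ℝ
  Pmax : ℝ

namespace TxSystem

/-- Energy actually stored in a slot that starts with battery level `Eb`, in which power `p` is
used and energy `ea` arrives: `min {Emax - (Eb - Δt p), ea, Ecmax}`. -/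
def harvested (S : TxSystem) (Eb p ea : ℝ) : ℝ :=
  min (S.Emax - (Eb - S.Δt * p)) (min ea S.Ecmax)

/-- Battery level at the beginning of the next slot. -/
def nextLevel (S : TxSystem) (Eb p ea : ℝ) : ℝ :=
  Eb - S.Δt * p + S.harvested Eb p ea

/-- Battery level `E_b(t)` from the initial level `Eb0`, for the sequences of energy arrivals `ea`
and of transmit powers `p`. -/
def level (S : TxSystem) (Eb0 : ℝ) (ea p : ℕ → ℝ) : ℕ → ℝ
  | 0 => Eb0
  | t + 1 => S.nextLevel (level S Eb0 ea p t) (p t) (ea t)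

/-! ### The optimization problem -/

variable {Ω : Type*} [mΩ : MeasurableSpace Ω]

/-- `P` is a feasible power control policy: the power in slot `t` is determined by the information
`ℱ t` available in that slot, lies in `[0, Pmax]`, and draws no more energy than the battery can
supply above the level `Emin`. -/
structure IsFeasible (S : TxSystem) (μ : Measure Ω) (ℱ : Filtration ℕ mΩ) (Ea : ℕ → Ω → ℝ)
    (Eb0 : ℝ) (P : ℕ → Ω → ℝ) : Prop where
  causal : ∀ t, Measurable[ℱ t] (P t)
  power_bound : ∀ t, ∀ᵐ ω ∂μ, 0 ≤ P t ω ∧ P t ω ≤ S.Pmax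
  battery_bound : ∀ t, ∀ᵐ ω ∂μ,
    S.Δt * P t ω ≤ S.level Eb0 (fun τ => Ea τ ω) (fun τ => P τ ω) t - S.Emin

/-- The time-averaged expected rate `(1/T) ∑_{t<T} 𝔼[log (1 + P(t) γ(t))]`, in `[0, ∞]`. -/
def avgRate (μ : Measure Ω) (γ P : ℕ → Ω → ℝ) (T : ℕ) : ENNReal :=
  (∑ t ∈ Finset.range T, ∫⁻ ω, ENNReal.ofReal (Real.log (1 + P t ω * γ t ω)) ∂μ) / (T : ENNReal)

/-- Optimal value of the rate maximization problem: the supremum over all feasible policies of the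
long-term time-averaged expected rate. The upper limit is used, so that policies whose averages do
not converge compete as well. -/
def optRate (S : TxSystem) (μ : Measure Ω) (ℱ : Filtration ℕ mΩ) (Ea γ : ℕ → Ω → ℝ)
    (Eb0 : ℝ) : ENNReal :=
  ⨆ (P : ℕ → Ω → ℝ) (_ : S.IsFeasible μ ℱ Ea Eb0 P), limsup (avgRate μ γ P) atTop

/-! ### The online algorithm -/

/-- `ζ_max = γ_max / Δt`. -/
def ζmax (S : TxSystem) (γmax : ℝ) : ℝ := γmax / S.Δt

/-- The largest admissible weight `V`. -/
def Vmax (S : TxSystem) (γmax : ℝ) : ℝ :=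
  (S.Emax - S.Emin - S.Ecmax - S.Δt * S.Pmax) / S.ζmax γmax

/-- Lower battery threshold, for channel gain `g`. -/
def threshold₁ (S : TxSystem) (V γmax g : ℝ) : ℝ :=
  S.Δt * S.Pmax + S.Emin + V * (S.ζmax γmax - g / S.Δt)

/-- Upper battery threshold, for channel gain `g`. -/
def threshold₂ (S : TxSystem) (V γmax g : ℝ) : ℝ :=
  S.Δt * S.Pmax + S.Emin + V * (S.ζmax γmax - g / (S.Δt * (S.Pmax * g + 1)))

/-- The three-stage power `P*` at battery level `Eb` and channel gain `g`. (In the degenerate case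
where `g = 0` and both thresholds equal `Eb`, the value is `0`.) -/
def powerStar (S : TxSystem) (V γmax Eb g : ℝ) : ℝ :=
  if Eb < S.threshold₁ V γmax g then 0
  else if Eb ≤ S.threshold₂ V γmax g then
    V / (S.Δt * (V * S.ζmax γmax + S.Δt * S.Pmax + S.Emin - Eb)) - 1 / g
  else S.Pmax

/-- The power `P^s` used by the algorithm at battery level `Eb`, channel gain `g` and past average
`Ebar` of the end-of-slot battery levels: the power `P*`, unless there is an outage (`g > γmax`)
and `P*` needs more energy than is available. -/
def powerAlg (S : TxSystem) (V γmax Eb Ebar g : ℝ) : ℝ :=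
  if γmax < g ∧ (Eb - S.Emin) / S.Δt < S.powerStar V γmax Eb g then
    max ((Eb - Ebar) / S.Δt) 0
  else S.powerStar V γmax Eb g

/-- The state `(E_b(t), Ē(t-1))` of the algorithm at the beginning of slot `t`, for the sequences
of energy arrivals `ea` and gains `g`; here `Ē(t)` is the average over the slots `1, …, t` of the
end-of-slot levels `E_b(τ) - Δt P^s(τ)`, which the algorithm updates recursively. No such average
exists before the end of slot `1`, and until then the algorithm uses a given value `Ebar0`. -/
def algState (S : TxSystem) (V γmax Eb0 Ebar0 : ℝ) (ea g : ℕ → ℝ) : ℕ → ℝ × ℝ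
  | 0 => (Eb0, Ebar0)
  | t + 1 =>
    let s := algState S V γmax Eb0 Ebar0 ea g t
    let p := S.powerAlg V γmax s.1 s.2 (g t)
    (S.nextLevel s.1 p (ea t),
      if t = 0 then Ebar0
      else (1 / (t : ℝ)) * (((t : ℝ) - 1) * s.2 + (s.1 - S.Δt * p)))

/-- The transmit power process generated by the algorithm. -/
def algPower (S : TxSystem) (V γmax Eb0 Ebar0 : ℝ) (Ea γ : ℕ → Ω → ℝ) (t : ℕ) (ω : Ω) : ℝ :=
  let s := S.algState V γmax Eb0 Ebar0 (fun τ => Ea τ ω) (fun τ => γ τ ω) t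
  S.powerAlg V γmax s.1 s.2 (γ t ω)

/-- Long-term time-averaged expected rate of the algorithm. The lower limit is used, because the
averages need not be known to converge. -/
def algRate (S : TxSystem) (μ : Measure Ω) (V γmax Eb0 Ebar0 : ℝ) (Ea γ : ℕ → Ω → ℝ) : ENNReal :=
  liminf (avgRate μ γ (S.algPower V γmax Eb0 Ebar0 Ea γ)) atTop

/-! ### The constants of the bound -/

/-- `B = max {Ecmax, Δt Pmax}² / 2`. -/
def B (S : TxSystem) : ℝ := (max S.Ecmax (S.Δt * S.Pmax)) ^ 2 / 2

/-- `G = 𝔼[log (1 + Pmax γ) | γ > γmax]`, in `[0, ∞]`, where `γ₀` is a random variable with the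
distribution of the channel gain. -/
def G (S : TxSystem) (μ : Measure Ω) (γmax : ℝ) (γ₀ : Ω → ℝ) : ENNReal :=
  ∫⁻ ω, ENNReal.ofReal (Real.log (1 + S.Pmax * γ₀ ω)) ∂(ProbabilityTheory.cond μ {ω | γmax < γ₀ ω})

end TxSystem

end

open MeasureTheory ProbabilityTheory Filter Topology

namespace TxSystem

/-! The proof is a Lyapunov drift argument read as Lagrangian duality. Take the displacement of the
battery from `refLevel` as the multiplier of the long-run energy balance. The three-stage power is
then the exact maximizer of the concave one-slot Lagrangian (`powerStar_spec`, `lagrangian_le`).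

Weak duality (`optRate_le_dual`): for every fixed level `b`, the mean of `dualSlot` at `b` is at
least `V` times the optimal rate. Below `refLevel` this is the energy balance of a feasible policy.
Above it the multiplier has the wrong sign, but the dual value already exceeds the rate at full
power.

The bound on `V` leaves room for a full charge in every slot, so under the algorithm the battery
performs an exact walk. The square of its displacement telescopes and costs at most `B` per slot
(`dualSlot_le`). The battery level depends on past states only, hence is independent of the current
one, and weak duality may be applied with `b` replaced by the random level (`algPower_rate`).

In an outage the power may be cut back. This happens only at a low battery, where energy is so
expensive that the cut and the drift constant together cost at most `V log(1 + Pmax γ)`, provided `B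
≤ V log(1 + Pmax γmax)`. If that inequality fails, the bound is trivial: outside an outage even full
power earns at most `log(1 + Pmax γmax) < B / V`. -/

/-- Standing assumptions on the transmitter and on the parameters of the algorithm. -/
structure Admissible (S : TxSystem) (V γmax : ℝ) : Prop where
  Δt_pos : 0 < S.Δt
  Pmax_pos : 0 < S.Pmax
  Ecmax_nonneg : 0 ≤ S.Ecmax
  Ecmax_le : S.Ecmax ≤ S.Δt * S.Pmax
  γmax_pos : 0 < γmax
  V_pos : 0 < V
  capacity : V * S.ζmax γmax ≤ S.Emax - S.Emin - S.Ecmax - S.Δt * S.Pmax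

/-- The reference level of the battery, at which the multiplier of the energy constraint
vanishes. -/
noncomputable def refLevel (S : TxSystem) (V γmax : ℝ) : ℝ :=
  V * S.ζmax γmax + S.Δt * S.Pmax + S.Emin

/-- The weighted rate minus the price of the transmit energy, at battery level `b`. -/
noncomputable def lagrangian (S : TxSystem) (V γmax b g p : ℝ) : ℝ :=
  V * Real.log (1 + p * g) + (b - S.refLevel V γmax) * (S.Δt * p)

/-- The dual function of one slot: the maximal Lagrangian plus the value of the energy charged. -/
noncomputable def dualSlot (S : TxSystem) (V γmax b g a : ℝ) : ℝ :=
  S.lagrangian V γmax b g (S.powerStar V γmax b g)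
    - (b - S.refLevel V γmax) * min a S.Ecmax

/-! ### Elementary inequalities for the logarithmic rate. -/

lemma log_one_add_mul_le_tangent {p q g : ℝ} (hp : 0 ≤ p) (hq : 0 ≤ q) (hg : 0 ≤ g) :
    Real.log (1 + q * g) ≤ Real.log (1 + p * g) + g / (1 + p * g) * (q - p) := by
  have h1 : 0 < 1 + p * g := by positivity
  have h2 : 0 < 1 + q * g := by positivity
  have h := Real.log_le_sub_one_of_pos (div_pos h2 h1)
  rw [Real.log_div h2.ne' h1.ne'] at h
  have : (1 + q * g) / (1 + p * g) - 1 = g / (1 + p * g) * (q - p) := by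
    field_simp
    ring
  linarith

lemma log_one_add_mul_mono {p q g : ℝ} (hp : 0 ≤ p) (hpq : p ≤ q) (hg : 0 ≤ g) :
    Real.log (1 + p * g) ≤ Real.log (1 + q * g) := by
  have : p * g ≤ q * g := by gcongr
  exact Real.log_le_log (by positivity) (by linarith)

lemma log_one_add_mul_nonneg {p g : ℝ} (hp : 0 ≤ p) (hg : 0 ≤ g) :
    0 ≤ Real.log (1 + p * g) :=
  Real.log_nonneg (by linarith [mul_nonneg hp hg])

/-- With `p` the size of a cutback and `gm` the least price of power, this leaves room for the drift
constant within the full-power rate. It holds because `log(1 + P g) - log(1 + p g)` is nondecreasing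
in `g` for `p ≤ P`, while `log(1 + p gm) ≤ gm p`. -/
lemma log_add_log_le_of_outage {p P g gm : ℝ} (hp : 0 ≤ p) (hpP : p ≤ P) (hgm : 0 ≤ gm)
    (hg : gm ≤ g) :
    Real.log (1 + p * g) - gm * p + Real.log (1 + P * gm) ≤ Real.log (1 + P * g) := by
  have hP := hp.trans hpP
  have hg0 := hgm.trans hg
  have h1 : Real.log (1 + p * gm) ≤ gm * p := by
    have := Real.log_le_sub_one_of_pos (show 0 < 1 + p * gm by positivity)
    linarith
  have h2 : Real.log (1 + p * g) + Real.log (1 + P * gm)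
      ≤ Real.log (1 + p * gm) + Real.log (1 + P * g) := by
    rw [← Real.log_mul (by positivity) (by positivity),
      ← Real.log_mul (by positivity) (by positivity)]
    refine Real.log_le_log (by positivity) ?_
    nlinarith [mul_nonneg (sub_nonneg.2 hpP) (sub_nonneg.2 hg)]
  linarith

lemma log_sub_log_le {p q g : ℝ} (hq : 0 ≤ q) (hqp : q ≤ p) (hg : 0 ≤ g) :
    Real.log (1 + p * g) - Real.log (1 + q * g) ≤ Real.log (1 + (p - q) * g) := by
  have hp := hq.trans hqp
  have hd : 0 ≤ p - q := sub_nonneg.2 hqp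
  rw [sub_le_iff_le_add, ← Real.log_mul (by positivity) (by positivity)]
  refine Real.log_le_log (by positivity) ?_
  nlinarith [mul_nonneg (mul_nonneg hd hg) (mul_nonneg hq hg)]

/-! ### The three-stage power as maximizer of the Lagrangian. -/

variable {S : TxSystem} {V γmax : ℝ}

lemma Admissible.mul_ζmax (h : S.Admissible V γmax) : S.Δt * (V * S.ζmax γmax) = V * γmax := by
  have := h.Δt_pos.ne'
  unfold ζmax
  field_simp

lemma Admissible.ζmax_pos (h : S.Admissible V γmax) : 0 < V * S.ζmax γmax :=
  mul_pos h.V_pos (div_pos h.γmax_pos h.Δt_pos)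

/-- The right-hand expression is the derivative of the Lagrangian at zero power; the upper threshold
plays the same role at `Pmax`. -/
lemma Admissible.lt_threshold₁_iff (h : S.Admissible V γmax) {b g : ℝ} :
    b < S.threshold₁ V γmax g ↔ V * g + (b - S.refLevel V γmax) * S.Δt < 0 := by
  have := h.Δt_pos
  have e : V * g + (b - S.refLevel V γmax) * S.Δt = (b - S.threshold₁ V γmax g) * S.Δt := by
    unfold threshold₁ refLevel
    field_simp
    ring
  rw [e]
  constructor
  · intro hb
    exact mul_neg_of_neg_of_pos (sub_neg.2 hb) this
  · intro hb
    exact sub_neg.1 (neg_of_mul_neg_left hb this.le)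

lemma Admissible.le_threshold₂_iff (h : S.Admissible V γmax) {b g : ℝ} (hg : 0 ≤ g) :
    b ≤ S.threshold₂ V γmax g ↔
      V * g / (1 + S.Pmax * g) + (b - S.refLevel V γmax) * S.Δt ≤ 0 := by
  have := h.Δt_pos
  have hP := h.Pmax_pos
  have h1 : 0 < 1 + S.Pmax * g := by positivity
  have h2 : S.Pmax * g + 1 ≠ 0 := by linarith
  have e : V * g / (1 + S.Pmax * g) + (b - S.refLevel V γmax) * S.Δt
      = (b - S.threshold₂ V γmax g) * S.Δt := by
    unfold threshold₂ refLevel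
    rw [add_comm (1 : ℝ)]
    field_simp
    ring
  rw [e]
  constructor
  · intro hb
    exact mul_nonpos_of_nonpos_of_nonneg (sub_nonpos.2 hb) this.le
  · intro hb
    exact sub_nonpos.1 (nonpos_of_mul_nonpos_left hb this)

/-- The power `P*` is admissible and satisfies the first-order optimality conditions. -/
lemma Admissible.powerStar_spec (h : S.Admissible V γmax) {b g : ℝ} (hg : 0 ≤ g) :
    S.powerStar V γmax b g ∈ Set.Icc 0 S.Pmax ∧
      ∀ q ∈ Set.Icc 0 S.Pmax,
        (V * g / (1 + S.powerStar V γmax b g * g) + (b - S.refLevel V γmax) * S.Δt)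
          * (q - S.powerStar V γmax b g) ≤ 0 := by
  have hP := h.Pmax_pos
  have ht := h.Δt_pos
  have hV := h.V_pos
  unfold powerStar
  split_ifs with h1 h2
  · rw [h.lt_threshold₁_iff] at h1
    refine ⟨⟨le_rfl, hP.le⟩, fun q hq => ?_⟩
    simp only [zero_mul, add_zero, div_one, sub_zero]
    exact mul_nonpos_of_nonpos_of_nonneg h1.le hq.1
  · rw [h.lt_threshold₁_iff, not_lt] at h1
    rw [h.le_threshold₂_iff hg] at h2
    have e : V * S.ζmax γmax + S.Δt * S.Pmax + S.Emin - b = -(b - S.refLevel V γmax) := by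
      unfold refLevel
      ring
    rw [e]
    set x := b - S.refLevel V γmax with hx
    -- For `g = 0` the two threshold conditions force `x = 0`, and both quotients in the middle
    -- stage are divisions by zero, with value `0`.
    rcases hg.eq_or_lt with rfl | hg
    · have hx0 : x = 0 := by
        simp only [mul_zero, zero_add, zero_div] at h1 h2
        nlinarith
      simp [hx0, hP.le]
    · have h1P : 0 < 1 + S.Pmax * g := by positivity
      have hxneg : x < 0 := by
        have : 0 < V * g / (1 + S.Pmax * g) := by positivity
        by_contra hc
        have := mul_nonneg (not_lt.1 hc) ht.le
        linarith
      have hx' : 0 < S.Δt * -x := mul_pos ht (neg_pos.2 hxneg)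
      have hone : 1 + (V / (S.Δt * -x) - 1 / g) * g = V * g / (S.Δt * -x) := by
        field_simp
        ring
      have h2' : V * g ≤ S.Δt * -x * (1 + S.Pmax * g) := by
        rw [← div_le_iff₀ h1P]
        linarith
      refine ⟨⟨?_, ?_⟩, fun q hq => ?_⟩
      · rw [sub_nonneg, div_le_div_iff₀ hg hx']
        linarith
      · rw [sub_le_iff_le_add, div_le_iff₀ hx']
        have : (S.Pmax + 1 / g) * (S.Δt * -x) = S.Δt * -x * (1 + S.Pmax * g) / g := by
          field_simp
          ring
        rw [this, le_div_iff₀ hg]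
        exact h2'
      · rw [hone]
        -- In the middle stage the derivative of the Lagrangian vanishes.
        have : V * g / (V * g / (S.Δt * -x)) + x * S.Δt = 0 := by
          rw [div_div_cancel₀ (by positivity)]
          ring
        rw [this, zero_mul]
  · rw [h.le_threshold₂_iff hg, not_le] at h2
    exact ⟨⟨hP.le, le_rfl⟩, fun q hq =>
      mul_nonpos_of_nonneg_of_nonpos h2.le (sub_nonpos.2 hq.2)⟩

lemma Admissible.powerStar_mem (h : S.Admissible V γmax) {b g : ℝ} (hg : 0 ≤ g) :
    S.powerStar V γmax b g ∈ Set.Icc 0 S.Pmax :=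
  (h.powerStar_spec hg).1

/-- By concavity, the first-order conditions suffice: the tangent at the optimum lies above the
rate. -/
lemma Admissible.lagrangian_le (h : S.Admissible V γmax) {b g q : ℝ} (hg : 0 ≤ g)
    (hq : q ∈ Set.Icc 0 S.Pmax) :
    S.lagrangian V γmax b g q ≤ S.lagrangian V γmax b g (S.powerStar V γmax b g) := by
  obtain ⟨hp, hopt⟩ := h.powerStar_spec (b := b) hg
  have h1 := mul_le_mul_of_nonneg_left (log_one_add_mul_le_tangent hp.1 hq.1 hg) h.V_pos.le
  have h2 := hopt q hq
  unfold lagrangian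
  set p := S.powerStar V γmax b g
  have h3 : V * (g / (1 + p * g) * (q - p)) = V * g / (1 + p * g) * (q - p) := by ring
  nlinarith

/-- At such a level a unit of power costs more than `V γmax`, the largest marginal weighted rate
without outage. Hence only an outage can make the optimal power exceed the available energy. -/
lemma Admissible.powerStar_eq_zero (h : S.Admissible V γmax) {b g : ℝ} (hg : g ≤ γmax)
    (hb : b < S.Emin + S.Δt * S.Pmax) : S.powerStar V γmax b g = 0 := by
  refine if_pos (h.lt_threshold₁_iff.2 ?_)
  have h1 := h.mul_ζmax
  have h2 := mul_le_mul_of_nonneg_left hg h.V_pos.le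
  have h3 : (b - S.refLevel V γmax) * S.Δt < -(V * S.ζmax γmax) * S.Δt :=
    mul_lt_mul_of_pos_right (by unfold refLevel; linarith) h.Δt_pos
  linarith

lemma Admissible.powerStar_eq_Pmax (h : S.Admissible V γmax) {b g : ℝ} (hg : 0 ≤ g)
    (hb : S.refLevel V γmax < b) : S.powerStar V γmax b g = S.Pmax := by
  have hx : 0 < (b - S.refLevel V γmax) * S.Δt := mul_pos (sub_pos.2 hb) h.Δt_pos
  have hV := h.V_pos
  have hP := h.Pmax_pos
  have h1 : ¬ b < S.threshold₁ V γmax g := by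
    rw [h.lt_threshold₁_iff, not_lt]
    positivity
  have h2 : ¬ b ≤ S.threshold₂ V γmax g := by
    rw [h.le_threshold₂_iff hg, not_le]
    positivity
  unfold powerStar
  rw [if_neg h1, if_neg h2]

/-! ### Feasibility of the algorithm and absence of overflow. -/

/-- The power of the algorithm is either `P*`, or at most `P*` in an outage with low battery. -/
lemma Admissible.powerAlg_spec (h : S.Admissible V γmax) {b e g : ℝ} (hg : 0 ≤ g)
    (hb : b ∈ Set.Icc S.Emin S.Emax) (he : S.Emin ≤ e) :
    S.powerAlg V γmax b e g ∈ Set.Icc 0 S.Pmax ∧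
      S.Δt * S.powerAlg V γmax b e g ≤ b - S.Emin ∧
      S.Ecmax ≤ S.Emax - (b - S.Δt * S.powerAlg V γmax b e g) ∧
      (S.powerAlg V γmax b e g = S.powerStar V γmax b g ∨
        γmax < g ∧ b < S.Emin + S.Δt * S.Pmax ∧
          S.powerAlg V γmax b e g ≤ S.powerStar V γmax b g) := by
  have ht := h.Δt_pos
  have hp := h.powerStar_mem (b := b) hg
  have hcap := h.capacity
  have hζ := h.ζmax_pos
  unfold powerAlg
  split_ifs with hc
  · obtain ⟨hgm, hlow⟩ := hc
    have hb2 : b < S.Emin + S.Δt * S.Pmax := by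
      have := hlow.trans_le hp.2
      rw [div_lt_iff₀ ht] at this
      linarith
    -- The fallback discharges towards `e ≥ Emin`, so it stays within the available energy.
    have hle : max ((b - e) / S.Δt) 0 ≤ (b - S.Emin) / S.Δt :=
      max_le (by gcongr) (div_nonneg (sub_nonneg.2 hb.1) ht.le)
    have hle' : S.Δt * max ((b - e) / S.Δt) 0 ≤ b - S.Emin := by
      rw [le_div_iff₀ ht] at hle
      linarith
    have h0 : 0 ≤ max ((b - e) / S.Δt) 0 := le_max_right _ _
    refine ⟨⟨h0, (hle.trans hlow.le).trans hp.2⟩, hle', ?_, Or.inr ⟨hgm, hb2, hle.trans hlow.le⟩⟩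
    have := mul_nonneg ht.le h0
    linarith
  · refine ⟨hp, ?_, ?_, Or.inl rfl⟩
    · rcases le_or_gt g γmax with hgm | hgm
      · rcases lt_or_ge b (S.Emin + S.Δt * S.Pmax) with hb2 | hb2
        · rw [h.powerStar_eq_zero hgm hb2]
          linarith [hb.1]
        · have := mul_le_mul_of_nonneg_left hp.2 ht.le
          linarith
      · have := not_lt.1 fun hl => hc ⟨hgm, hl⟩
        rw [le_div_iff₀ ht] at this
        linarith
    -- Up to `refLevel`, the capacity bound on `V` leaves room for a full charge; above it, full
    -- power frees at least `Ecmax`.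
    · rcases le_or_gt b (S.refLevel V γmax) with hb2 | hb2
      · have := mul_nonneg ht.le hp.1
        unfold refLevel at hb2
        linarith
      · rw [h.powerStar_eq_Pmax hg hb2]
        linarith [hb.2, h.Ecmax_le]

lemma Admissible.harvested_eq (h : S.Admissible V γmax) {b e g a : ℝ} (hg : 0 ≤ g)
    (hb : b ∈ Set.Icc S.Emin S.Emax) (he : S.Emin ≤ e) :
    S.harvested b (S.powerAlg V γmax b e g) a = min a S.Ecmax :=
  min_eq_right ((min_le_right _ _).trans (h.powerAlg_spec hg hb he).2.2.1)

/-- The battery and the running average of the algorithm stay in the admissible range. -/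
lemma Admissible.algState_mem (h : S.Admissible V γmax) {Eb0 Ebar0 : ℝ} {ea g : ℕ → ℝ}
    (hEb0 : Eb0 ∈ Set.Icc S.Emin S.Emax) (hEbar0 : S.Emin ≤ Ebar0)
    (hea : ∀ t, 0 ≤ ea t) (hg : ∀ t, 0 ≤ g t) (t : ℕ) :
    (S.algState V γmax Eb0 Ebar0 ea g t).1 ∈ Set.Icc S.Emin S.Emax ∧
      S.Emin ≤ (S.algState V γmax Eb0 Ebar0 ea g t).2 := by
  induction t with
  | zero => exact ⟨hEb0, hEbar0⟩
  | succ t ih =>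
    simp only [algState]
    set s := S.algState V γmax Eb0 Ebar0 ea g t
    obtain ⟨hp, hbat, hroom, -⟩ := h.powerAlg_spec (hg t) ih.1 ih.2
    have hm : 0 ≤ min (ea t) S.Ecmax := le_min (hea t) h.Ecmax_nonneg
    have hm' : min (ea t) S.Ecmax ≤ S.Ecmax := min_le_right _ _
    refine ⟨?_, ?_⟩
    · rw [nextLevel, h.harvested_eq (hg t) ih.1 ih.2]
      constructor <;> linarith
    · split_ifs with h0
      · exact hEbar0
      -- From `t = 1` on, the update is a convex combination with weights `(t - 1) / t` and `1 / t`;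
      -- at `t = 1` the initial value drops out.
      · have ht1 : (1 : ℝ) ≤ t := by exact_mod_cast Nat.one_le_iff_ne_zero.2 h0
        have h1 := mul_le_mul_of_nonneg_left ih.2 (sub_nonneg.2 ht1)
        rw [one_div, ← div_eq_inv_mul, le_div_iff₀ (by linarith)]
        linarith

/-! ### One-slot drift inequality and bounds on the dual function. -/

/-- The drift inequality: up to the change of the Lyapunov function, the weighted rate of the
algorithm falls short of the dual function by at most `B`, respectively by at most the weighted
rate at full power in an outage. -/
lemma Admissible.dualSlot_le (h : S.Admissible V γmax) {b e g a : ℝ} (hg : 0 ≤ g) (ha : 0 ≤ a)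
    (hb : b ∈ Set.Icc S.Emin S.Emax) (he : S.Emin ≤ e)
    (hB : S.B ≤ V * Real.log (1 + S.Pmax * γmax)) :
    S.dualSlot V γmax b g a ≤ V * Real.log (1 + S.powerAlg V γmax b e g * g)
      + ((b - S.refLevel V γmax) ^ 2 / 2
        - (S.nextLevel b (S.powerAlg V γmax b e g) a - S.refLevel V γmax) ^ 2 / 2)
      + (if γmax < g then V * Real.log (1 + S.Pmax * g) else S.B) := by
  obtain ⟨hp, hbat, -, hcase⟩ := h.powerAlg_spec hg hb he
  have ht := h.Δt_pos
  have hps := h.powerStar_mem (b := b) hg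
  rw [nextLevel, h.harvested_eq hg hb he]
  unfold dualSlot lagrangian
  set p := S.powerAlg V γmax b e g
  set q := S.powerStar V γmax b g
  set m := min a S.Ecmax with hmdef
  have hm0 : 0 ≤ m := le_min ha h.Ecmax_nonneg
  have hm1 : m ≤ S.Ecmax := min_le_right _ _
  have hsq : (m - S.Δt * p) ^ 2 / 2 ≤ S.B := by
    have h1 : 0 ≤ S.Δt * p := mul_nonneg ht.le hp.1
    have h2 : S.Δt * p ≤ S.Δt * S.Pmax := mul_le_mul_of_nonneg_left hp.2 ht.le
    have h3 := le_max_left S.Ecmax (S.Δt * S.Pmax)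
    have h4 := le_max_right S.Ecmax (S.Δt * S.Pmax)
    unfold B
    have : (m - S.Δt * p) ^ 2 ≤ (max S.Ecmax (S.Δt * S.Pmax)) ^ 2 :=
      sq_le_sq' (by linarith) (by linarith)
    linarith
  have hmono : γmax < g → V * Real.log (1 + S.Pmax * γmax) ≤ V * Real.log (1 + S.Pmax * g) := by
    intro hgm
    have h1 := h.Pmax_pos
    have h2 := h.γmax_pos
    have := h.V_pos
    have h3 : S.Pmax * γmax ≤ S.Pmax * g := by gcongr
    exact mul_le_mul_of_nonneg_left
      (Real.log_le_log (by positivity) (by linarith)) this.le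
  have hBle : S.B ≤ if γmax < g then V * Real.log (1 + S.Pmax * g) else S.B := by
    split_ifs with hgm
    · exact hB.trans (hmono hgm)
    · exact le_rfl
  rcases hcase with hpq | ⟨hgm, hlow, hpq⟩
  -- Without a cutback, expanding the squares shows that the loss is exactly `(m - Δt p) ^ 2 / 2`.
  · rw [← hpq]
    nlinarith
  · rw [if_pos hgm]
    have h1 := log_sub_log_le hp.1 hpq hg
    have h2 := log_add_log_le_of_outage (sub_nonneg.2 hpq)
      (show q - p ≤ S.Pmax by linarith [hp.1, hps.2]) h.γmax_pos.le hgm.le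
    have h3 := mul_le_mul_of_nonneg_left
      (show Real.log (1 + q * g) - Real.log (1 + p * g) - γmax * (q - p)
        + Real.log (1 + S.Pmax * γmax) ≤ Real.log (1 + S.Pmax * g) by linarith) h.V_pos.le
    -- The low battery puts the displacement below `-V ζmax`, so each unit of power cut back saves
    -- at least `V γmax`.
    have h4 : (b - S.refLevel V γmax) * (S.Δt * (q - p)) ≤ -(V * γmax) * (q - p) := by
      rw [← h.mul_ζmax]
      have h5 := mul_le_mul_of_nonneg_right
        (show b - S.refLevel V γmax ≤ -(V * S.ζmax γmax) by unfold refLevel; linarith)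
        (mul_nonneg ht.le (sub_nonneg.2 hpq))
      linarith
    nlinarith

lemma Admissible.abs_dualSlot_le (h : S.Admissible V γmax) {b g a M : ℝ} (hg : 0 ≤ g)
    (ha : 0 ≤ a) (hb : |b - S.refLevel V γmax| ≤ M) :
    |S.dualSlot V γmax b g a| ≤
      V * Real.log (1 + S.Pmax * g) + M * (S.Δt * S.Pmax + S.Ecmax) := by
  have hp := h.powerStar_mem (b := b) hg
  have ht := h.Δt_pos
  unfold dualSlot lagrangian
  set p := S.powerStar V γmax b g
  have hm0 : 0 ≤ min a S.Ecmax := le_min ha h.Ecmax_nonneg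
  have hm1 : min a S.Ecmax ≤ S.Ecmax := min_le_right _ _
  have hl0 := mul_nonneg h.V_pos.le (log_one_add_mul_nonneg hp.1 hg)
  have hl1 := mul_le_mul_of_nonneg_left (log_one_add_mul_mono hp.1 hp.2 hg) h.V_pos.le
  have hp1 : S.Δt * p ≤ S.Δt * S.Pmax := mul_le_mul_of_nonneg_left hp.2 ht.le
  have hp0 : 0 ≤ S.Δt * p := mul_nonneg ht.le hp.1
  have hd : |(b - S.refLevel V γmax) * (S.Δt * p - min a S.Ecmax)| ≤
      M * (S.Δt * S.Pmax + S.Ecmax) := by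
    rw [abs_mul]
    refine mul_le_mul hb ?_ (abs_nonneg _) ((abs_nonneg _).trans hb)
    rw [abs_le]
    constructor <;> linarith [h.Ecmax_nonneg, mul_pos ht h.Pmax_pos]
  rw [abs_le] at hd ⊢
  constructor <;> nlinarith

end TxSystem

namespace TxSystem

variable {Ω : Type*} [mΩ : MeasurableSpace Ω] {μ : Measure Ω} {S : TxSystem} {V γmax : ℝ}
  {Ea γ : ℕ → Ω → ℝ}

/-- The energy arrivals and the channel gains are nonnegative and i.i.d. over time. -/
structure IsStateProcess (μ : Measure Ω) (Ea γ : ℕ → Ω → ℝ) : Prop where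
  measurable_Ea : ∀ t, Measurable (Ea t)
  measurable_γ : ∀ t, Measurable (γ t)
  Ea_nonneg : ∀ t ω, 0 ≤ Ea t ω
  γ_nonneg : ∀ t ω, 0 ≤ γ t ω
  indep : iIndepFun (fun t ω => (Ea t ω, γ t ω)) μ
  ident : ∀ t, IdentDistrib (fun ω => (Ea t ω, γ t ω)) (fun ω => (Ea 0 ω, γ 0 ω)) μ μ

lemma IsStateProcess.ident_γ (hZ : IsStateProcess μ Ea γ) (t : ℕ) :
    IdentDistrib (γ t) (γ 0) μ μ :=
  (hZ.ident t).comp measurable_snd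

/-! ### Measurability -/

lemma measurable_powerStar :
    Measurable (fun x : ℝ × ℝ => S.powerStar V γmax x.1 x.2) := by
  unfold powerStar threshold₁ threshold₂
  refine Measurable.ite (measurableSet_lt (by fun_prop) (by fun_prop)) (by fun_prop) ?_
  exact Measurable.ite (measurableSet_le (by fun_prop) (by fun_prop)) (by fun_prop) (by fun_prop)

lemma measurable_powerAlg :
    Measurable (fun x : ℝ × ℝ × ℝ => S.powerAlg V γmax x.1 x.2.1 x.2.2) := by
  have h : Measurable (fun x : ℝ × ℝ × ℝ => S.powerStar V γmax x.1 x.2.2) :=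
    measurable_powerStar.comp (measurable_fst.prodMk measurable_snd.snd)
  unfold powerAlg
  refine Measurable.ite (MeasurableSet.inter ?_ ?_) (by fun_prop) h
  · exact measurableSet_lt measurable_const measurable_snd.snd
  · exact measurableSet_lt (by fun_prop) h

lemma measurable_dualSlot :
    Measurable (fun x : ℝ × ℝ × ℝ => S.dualSlot V γmax x.1 x.2.2 x.2.1) := by
  have h : Measurable (fun x : ℝ × ℝ × ℝ => S.powerStar V γmax x.1 x.2.2) :=
    measurable_powerStar.comp (measurable_fst.prodMk measurable_snd.snd)
  unfold dualSlot lagrangian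
  fun_prop

lemma measurable_algState {α : Type*} [MeasurableSpace α] {ea g : ℕ → α → ℝ} {Eb0 Ebar0 : ℝ}
    (hea : ∀ t, Measurable (ea t)) (hg : ∀ t, Measurable (g t)) (t : ℕ) :
    Measurable fun x =>
      S.algState V γmax Eb0 Ebar0 (fun τ => ea τ x) (fun τ => g τ x) t := by
  induction t with
  | zero => exact measurable_const
  | succ t ih =>
    have hp := measurable_powerAlg (S := S) (V := V) (γmax := γmax) |>.comp
      (ih.fst.prodMk (ih.snd.prodMk (hg t)))
    have h1 := ih.fst
    have h2 := ih.snd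
    have h3 := hea t
    simp only [Function.comp_def] at hp
    simp only [algState, nextLevel, harvested]
    refine Measurable.prodMk (by fun_prop) ?_
    split_ifs
    · exact measurable_const
    · fun_prop

lemma measurable_algPower {Eb0 Ebar0 : ℝ} (hEa : ∀ t, Measurable (Ea t))
    (hγ : ∀ t, Measurable (γ t)) (t : ℕ) :
    Measurable (S.algPower V γmax Eb0 Ebar0 Ea γ t) := by
  have h := measurable_algState (S := S) (V := V) (γmax := γmax) (Eb0 := Eb0) (Ebar0 := Ebar0)
    hEa hγ t
  exact measurable_powerAlg.comp (h.fst.prodMk (h.snd.prodMk (hγ t)))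

lemma algState_congr {Eb0 Ebar0 : ℝ} {ea ea' g g' : ℕ → ℝ} (t : ℕ)
    (hea : ∀ τ < t, ea τ = ea' τ) (hg : ∀ τ < t, g τ = g' τ) :
    S.algState V γmax Eb0 Ebar0 ea g t = S.algState V γmax Eb0 Ebar0 ea' g' t := by
  induction t with
  | zero => rfl
  | succ t ih =>
    simp only [algState]
    rw [ih (fun τ h => hea τ (h.trans t.lt_succ_self)) (fun τ h => hg τ (h.trans t.lt_succ_self)),
      hea t t.lt_succ_self, hg t t.lt_succ_self]

/-- The state of the algorithm depends on the past only. -/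
lemma IsStateProcess.indepFun_algState [IsProbabilityMeasure μ] (hZ : IsStateProcess μ Ea γ)
    (Eb0 Ebar0 : ℝ) (t : ℕ) :
    IndepFun
      (fun ω => S.algState V γmax Eb0 Ebar0 (fun τ => Ea τ ω) (fun τ => γ τ ω) t)
      (fun ω => (Ea t ω, γ t ω)) μ := by
  have hind := hZ.indep.indepFun_finset (Finset.range t) {t}
    (by simp) (fun i => (hZ.measurable_Ea i).prodMk (hZ.measurable_γ i))
  let past : (Finset.range t → ℝ × ℝ) → ℕ → ℝ × ℝ :=
    fun z τ => if h : τ ∈ Finset.range t then z ⟨τ, h⟩ else 0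
  have hpast : ∀ τ, Measurable fun z => past z τ := by
    intro τ
    by_cases h : τ ∈ Finset.range t
    · simp only [past, h, dif_pos]
      exact measurable_pi_apply _
    · simp only [past, h, dif_neg, not_false_eq_true]
      exact measurable_const
  have hF := measurable_algState (S := S) (V := V) (γmax := γmax) (Eb0 := Eb0) (Ebar0 := Ebar0)
    (fun τ => (hpast τ).fst) (fun τ => (hpast τ).snd) t
  have hG : Measurable fun z : ({t} : Finset ℕ) → ℝ × ℝ => z ⟨t, by simp⟩ :=
    measurable_pi_apply _
  have h := hind.comp hF hG
  convert h using 1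
  · funext ω
    refine algState_congr t (fun τ hτ => ?_) (fun τ hτ => ?_) <;> simp [past, hτ]
  · rfl

/-- The joint law is a product, so Fubini allows the first variable to be frozen. -/
lemma le_integral_of_indepFun {α β : Type*} [MeasurableSpace α] [MeasurableSpace β]
    [IsProbabilityMeasure μ] {X : Ω → α} {Z : Ω → β} {f : α × β → ℝ} (hX : Measurable X)
    (hZ : Measurable Z) (hf : Measurable f) (hind : IndepFun X Z μ)
    (hint : Integrable (fun ω => f (X ω, Z ω)) μ) {c : ℝ}
    (hc : ∀ x, c ≤ ∫ ω, f (x, Z ω) ∂μ) :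
    c ≤ ∫ ω, f (X ω, Z ω) ∂μ := by
  have hXZ : Measurable fun ω => (X ω, Z ω) := hX.prodMk hZ
  have hmap := (indepFun_iff_map_prod_eq_prod_map_map hX.aemeasurable hZ.aemeasurable).1 hind
  have : IsProbabilityMeasure (μ.map X) := Measure.isProbabilityMeasure_map hX.aemeasurable
  have : IsProbabilityMeasure (μ.map Z) := Measure.isProbabilityMeasure_map hZ.aemeasurable
  have hint' : Integrable f ((μ.map X).prod (μ.map Z)) := by
    rw [← hmap]
    exact (integrable_map_measure hf.aestronglyMeasurable hXZ.aemeasurable).2 hint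
  rw [← integral_map (f := f) hXZ.aemeasurable hf.aestronglyMeasurable, hmap,
    integral_prod _ hint']
  have h1 : ∫ _, c ∂(μ.map X) = c := by simp
  rw [← h1]
  refine integral_mono (integrable_const _) hint'.integral_prod_left fun x => ?_
  have hfx : Measurable fun z => f (x, z) := hf.comp measurable_prodMk_left
  have h2 := integral_map (μ := μ) hZ.aemeasurable hfx.aestronglyMeasurable
  rw [h2]
  exact hc x

/-! ### Average rates -/

lemma IsStateProcess.integrable_log (hZ : IsStateProcess μ Ea γ)
    (hint : Integrable (fun ω => Real.log (1 + S.Pmax * γ 0 ω)) μ) {P : Ω → ℝ} (t : ℕ)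
    (hP : AEMeasurable P μ) (hPb : ∀ᵐ ω ∂μ, P ω ∈ Set.Icc 0 S.Pmax) :
    Integrable (fun ω => Real.log (1 + P ω * γ t ω)) μ := by
  have hφ : Measurable fun g : ℝ => Real.log (1 + S.Pmax * g) := by fun_prop
  have ht : Integrable (fun ω => Real.log (1 + S.Pmax * γ t ω)) μ :=
    ((hZ.ident_γ t).comp hφ).integrable_iff.2 hint
  have hm := hZ.measurable_γ t
  refine ht.mono' (by fun_prop : AEMeasurable _ μ).aestronglyMeasurable ?_
  filter_upwards [hPb] with ω hω
  have hg := hZ.γ_nonneg t ω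
  rw [Real.norm_of_nonneg (log_one_add_mul_nonneg hω.1 hg)]
  exact log_one_add_mul_mono hω.1 hω.2 hg

lemma IsStateProcess.avgRate_eq (hZ : IsStateProcess μ Ea γ)
    (hint : Integrable (fun ω => Real.log (1 + S.Pmax * γ 0 ω)) μ) {P : ℕ → Ω → ℝ}
    (hP : ∀ t, AEMeasurable (P t) μ) (hPb : ∀ t, ∀ᵐ ω ∂μ, P t ω ∈ Set.Icc 0 S.Pmax)
    {T : ℕ} (hT : 0 < T) :
    avgRate μ γ P T = ENNReal.ofReal
      ((∫ ω, ∑ t ∈ Finset.range T, Real.log (1 + P t ω * γ t ω) ∂μ) / T) := by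
  have hnn : ∀ t, 0 ≤ᵐ[μ] fun ω => Real.log (1 + P t ω * γ t ω) := fun t => by
    filter_upwards [hPb t] with ω hω
    exact log_one_add_mul_nonneg hω.1 (hZ.γ_nonneg t ω)
  have hi := fun t => hZ.integrable_log hint t (hP t) (hPb t)
  unfold avgRate
  rw [integral_finsetSum _ fun t _ => hi t, ENNReal.ofReal_div_of_pos (by exact_mod_cast hT),
    ENNReal.ofReal_natCast, ENNReal.ofReal_sum_of_nonneg fun t _ => integral_nonneg_of_ae (hnn t)]
  congr 1
  exact Finset.sum_congr rfl fun t _ => (ofReal_integral_eq_lintegral_ofReal (hi t) (hnn t)).symm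

lemma IsStateProcess.avgRate_le (hZ : IsStateProcess μ Ea γ) {P : ℕ → Ω → ℝ}
    (hPb : ∀ t, ∀ᵐ ω ∂μ, P t ω ∈ Set.Icc 0 S.Pmax) (T : ℕ) :
    avgRate μ γ P T ≤ ∫⁻ ω, ENNReal.ofReal (Real.log (1 + S.Pmax * γ 0 ω)) ∂μ := by
  unfold avgRate
  refine ENNReal.div_le_of_le_mul' ?_
  have hφ : Measurable fun g : ℝ => ENNReal.ofReal (Real.log (1 + S.Pmax * g)) := by fun_prop
  refine (Finset.sum_le_card_nsmul _ _ _ fun t _ => ?_).trans_eq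
    (by rw [Finset.card_range, nsmul_eq_mul])
  calc
    _ ≤ ∫⁻ ω, ENNReal.ofReal (Real.log (1 + S.Pmax * γ t ω)) ∂μ := by
      refine lintegral_mono_ae ?_
      filter_upwards [hPb t] with ω hω
      exact ENNReal.ofReal_le_ofReal (log_one_add_mul_mono hω.1 hω.2 (hZ.γ_nonneg t ω))
    _ = _ := ((hZ.ident_γ t).comp hφ).lintegral_eq

lemma IsStateProcess.optRate_le {ℱ : Filtration ℕ mΩ} {Eb0 : ℝ} (hZ : IsStateProcess μ Ea γ) :
    S.optRate μ ℱ Ea γ Eb0 ≤ ∫⁻ ω, ENNReal.ofReal (Real.log (1 + S.Pmax * γ 0 ω)) ∂μ :=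
  iSup₂_le fun _ hP => (limsup_le_limsup (Eventually.of_forall
    fun T => hZ.avgRate_le hP.power_bound T)).trans_eq (limsup_const _)

/-! ### Weak duality -/

/-- Above `refLevel` the multiplier rewards discharging, and full power uses at least as much energy
as can be charged. -/
lemma Admissible.mul_log_le_dualSlot (h : S.Admissible V γmax) {b g a : ℝ} (hg : 0 ≤ g)
    (hb : S.refLevel V γmax < b) :
    V * Real.log (1 + S.Pmax * g) ≤ S.dualSlot V γmax b g a := by
  have hm : min a S.Ecmax ≤ S.Δt * S.Pmax := (min_le_right _ _).trans h.Ecmax_le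
  unfold dualSlot lagrangian
  rw [h.powerStar_eq_Pmax hg hb]
  nlinarith

lemma Admissible.dualSlot_nonneg (h : S.Admissible V γmax) {b g a : ℝ} (hg : 0 ≤ g)
    (ha : 0 ≤ a) : 0 ≤ S.dualSlot V γmax b g a := by
  rcases le_or_gt b (S.refLevel V γmax) with hb | hb
  · have h1 := h.lagrangian_le (b := b) hg ⟨le_rfl, h.Pmax_pos.le⟩
    have h2 : S.lagrangian V γmax b g 0 = 0 := by simp [lagrangian]
    have h3 := mul_nonneg (sub_nonneg.2 hb) (le_min ha h.Ecmax_nonneg)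
    unfold dualSlot
    linarith
  · exact (mul_nonneg h.V_pos.le (log_one_add_mul_nonneg h.Pmax_pos.le hg)).trans
      (h.mul_log_le_dualSlot hg hb)

lemma Admissible.integrable_dualSlot [IsProbabilityMeasure μ] (h : S.Admissible V γmax)
    (hZ : IsStateProcess μ Ea γ)
    (hint : Integrable (fun ω => Real.log (1 + S.Pmax * γ 0 ω)) μ) {Y : Ω → ℝ}
    (hY : Measurable Y) {M : ℝ} (hM : ∀ ω, |Y ω - S.refLevel V γmax| ≤ M) (t : ℕ) :
    Integrable (fun ω => S.dualSlot V γmax (Y ω) (γ t ω) (Ea t ω)) μ := by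
  have hi := hZ.integrable_log hint t (P := fun _ => S.Pmax) aemeasurable_const
    (Eventually.of_forall fun _ => ⟨h.Pmax_pos.le, le_rfl⟩)
  have hm := measurable_dualSlot (S := S) (V := V) (γmax := γmax) |>.comp
    (hY.prodMk ((hZ.measurable_Ea t).prodMk (hZ.measurable_γ t)))
  refine ((hi.const_mul V).add (integrable_const (M * (S.Δt * S.Pmax + S.Ecmax)))).mono'
    hm.aestronglyMeasurable (Eventually.of_forall fun ω => ?_)
  exact h.abs_dualSlot_le (hZ.γ_nonneg t ω) (hZ.Ea_nonneg t ω) (hM ω)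

/-- Overflow can only lose energy. -/
lemma level_le (Eb0 : ℝ) (ea p : ℕ → ℝ) (T : ℕ) :
    S.level Eb0 ea p T ≤
      Eb0 + ∑ t ∈ Finset.range T, (min (ea t) S.Ecmax - S.Δt * p t) := by
  induction T with
  | zero => simp [level]
  | succ T ih =>
    have : S.harvested (S.level Eb0 ea p T) (p T) (ea T) ≤ min (ea T) S.Ecmax := min_le_right _ _
    rw [Finset.sum_range_succ, level, nextLevel]
    linarith

lemma Admissible.limsup_avgRate_le [IsProbabilityMeasure μ] (h : S.Admissible V γmax)
    (hZ : IsStateProcess μ Ea γ)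
    (hint : Integrable (fun ω => Real.log (1 + S.Pmax * γ 0 ω)) μ) {ℱ : Filtration ℕ mΩ}
    {Eb0 : ℝ} {P : ℕ → Ω → ℝ} (hP : S.IsFeasible μ ℱ Ea Eb0 P) {b : ℝ}
    (hb : b ≤ S.refLevel V γmax) :
    limsup (avgRate μ γ P) atTop ≤
      ENNReal.ofReal ((∫ ω, S.dualSlot V γmax b (γ 0 ω) (Ea 0 ω) ∂μ) / V) := by
  set D := ∫ ω, S.dualSlot V γmax b (γ 0 ω) (Ea 0 ω) ∂μ with hD
  -- Any feasible policy can draw the initial reserve `Eb0 - Emin` beyond what it harvests; `K` is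
  -- its price, and it disappears after division by `T`.
  set K := (S.refLevel V γmax - b) * (Eb0 - S.Emin) with hK
  have hPm : ∀ t, AEMeasurable (P t) μ := fun t =>
    ((hP.causal t).mono (ℱ.le t) le_rfl).aemeasurable
  have hlim : Tendsto (fun T : ℕ => ENNReal.ofReal (D / V + K / V / T)) atTop
      (𝓝 (ENNReal.ofReal (D / V))) := by
    refine ENNReal.tendsto_ofReal ?_
    simpa using (tendsto_const_nhds (x := D / V)).add (tendsto_const_div_atTop_nhds_zero_nat (K / V))
  rw [← hlim.limsup_eq]
  refine limsup_le_limsup ?_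
  filter_upwards [eventually_gt_atTop 0] with T hT
  have hT' : (0 : ℝ) < T := by exact_mod_cast hT
  have hV := h.V_pos
  rw [hZ.avgRate_eq hint hPm hP.power_bound hT]
  refine ENNReal.ofReal_le_ofReal ?_
  have hdual := fun t => h.integrable_dualSlot hZ hint (Y := fun _ => b) measurable_const
    (fun _ => le_rfl) t
  have hrate := fun t => hZ.integrable_log hint t (hPm t) (hP.power_bound t)
  have hsame : ∀ t, ∫ ω, S.dualSlot V γmax b (γ t ω) (Ea t ω) ∂μ = D := fun t =>
    ((hZ.ident t).comp (measurable_dualSlot.comp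
      (measurable_prodMk_left (x := b)))).integral_eq
  have key : ∫ ω, V * ∑ t ∈ Finset.range T, Real.log (1 + P t ω * γ t ω) ∂μ ≤
      ∫ ω, ((∑ t ∈ Finset.range T, S.dualSlot V γmax b (γ t ω) (Ea t ω)) + K) ∂μ := by
    refine integral_mono_ae ((integrable_finsetSum _ fun t _ => hrate t).const_mul V)
      ((integrable_finsetSum _ fun t _ => hdual t).add (integrable_const K)) ?_
    filter_upwards [ae_all_iff.2 hP.power_bound, hP.battery_bound T] with ω hpow hbat
    have hlev := S.level_le Eb0 (fun τ => Ea τ ω) (fun τ => P τ ω) T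
    -- Nonnegative power and the battery constraint in slot `T` give a level of at least `Emin` at
    -- time `T`.
    have h0 : 0 ≤ S.Δt * P T ω := mul_nonneg h.Δt_pos.le (hpow T).1
    have hsum : ∑ t ∈ Finset.range T, V * Real.log (1 + P t ω * γ t ω) ≤
        ∑ t ∈ Finset.range T, (S.dualSlot V γmax b (γ t ω) (Ea t ω)
          - (S.refLevel V γmax - b) * (min (Ea t ω) S.Ecmax - S.Δt * P t ω)) := by
      refine Finset.sum_le_sum fun t _ => ?_
      have h1 := h.lagrangian_le (b := b) (hZ.γ_nonneg t ω) (hpow t)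
      have h2 : S.lagrangian V γmax b (γ t ω) (P t ω) = V * Real.log (1 + P t ω * γ t ω)
        + (b - S.refLevel V γmax) * (S.Δt * P t ω) := rfl
      unfold dualSlot
      linarith
    rw [Finset.sum_sub_distrib, ← Finset.mul_sum, ← Finset.mul_sum] at hsum
    have h3 := mul_le_mul_of_nonneg_left (show S.Emin - Eb0 ≤
      ∑ t ∈ Finset.range T, (min (Ea t ω) S.Ecmax - S.Δt * P t ω) by linarith)
      (sub_nonneg.2 hb)
    simp only [hK]
    linarith
  rw [integral_const_mul, integral_add (integrable_finsetSum _ fun t _ => hdual t)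
    (integrable_const K), integral_finsetSum _ fun t _ => hdual t] at key
  simp only [hsame, Finset.sum_const, Finset.card_range, nsmul_eq_mul, integral_const,
    probReal_univ, one_smul] at key
  rw [div_le_iff₀ hT']
  have : (D / V + K / V / T) * T = (T * D + K) / V := by
    field_simp
  rw [this, le_div_iff₀ hV]
  linarith

/-- The dual function of the average energy constraint bounds the optimal rate. -/
lemma Admissible.optRate_le_dual [IsProbabilityMeasure μ] (h : S.Admissible V γmax)
    (hZ : IsStateProcess μ Ea γ)
    (hint : Integrable (fun ω => Real.log (1 + S.Pmax * γ 0 ω)) μ) {ℱ : Filtration ℕ mΩ}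
    {Eb0 : ℝ} (b : ℝ) :
    V * (S.optRate μ ℱ Ea γ Eb0).toReal ≤ ∫ ω, S.dualSlot V γmax b (γ 0 ω) (Ea 0 ω) ∂μ := by
  have hV := h.V_pos
  have h0 : 0 ≤ ∫ ω, S.dualSlot V γmax b (γ 0 ω) (Ea 0 ω) ∂μ := integral_nonneg fun ω =>
    h.dualSlot_nonneg (hZ.γ_nonneg 0 ω) (hZ.Ea_nonneg 0 ω)
  rw [mul_comm, ← le_div_iff₀ hV]
  refine ENNReal.toReal_le_of_le_ofReal (by positivity) ?_
  rcases le_or_gt b (S.refLevel V γmax) with hb | hb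
  · exact iSup₂_le fun P hP => h.limsup_avgRate_le hZ hint hP hb
  · refine hZ.optRate_le.trans ?_
    rw [← ofReal_integral_eq_lintegral_ofReal hint (Eventually.of_forall fun ω =>
      log_one_add_mul_nonneg h.Pmax_pos.le (hZ.γ_nonneg 0 ω))]
    refine ENNReal.ofReal_le_ofReal ?_
    rw [le_div_iff₀ hV, mul_comm, ← integral_const_mul]
    exact integral_mono (hint.const_mul V) (h.integrable_dualSlot hZ hint measurable_const
      (fun _ => le_rfl) 0) fun ω => h.mul_log_le_dualSlot (hZ.γ_nonneg 0 ω) hb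

/-! ### Performance of the algorithm -/

lemma integral_loss [IsProbabilityMeasure μ] (hZ : IsStateProcess μ Ea γ)
    (hint : Integrable (fun ω => Real.log (1 + S.Pmax * γ 0 ω)) μ) (t : ℕ) :
    Integrable (fun ω => if γmax < γ t ω then V * Real.log (1 + S.Pmax * γ t ω) else S.B) μ ∧
    ∫ ω, (if γmax < γ t ω then V * Real.log (1 + S.Pmax * γ t ω) else S.B) ∂μ =
      V * (∫ ω in {ω | γmax < γ 0 ω}, Real.log (1 + S.Pmax * γ 0 ω) ∂μ)
        + (1 - μ.real {ω | γmax < γ 0 ω}) * S.B := by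
  have hφ : Measurable fun g : ℝ =>
      if γmax < g then V * Real.log (1 + S.Pmax * g) else S.B :=
    Measurable.ite (measurableSet_lt (by fun_prop) (by fun_prop)) (by fun_prop) (by fun_prop)
  have hA : MeasurableSet {ω | γmax < γ 0 ω} :=
    measurableSet_lt measurable_const (hZ.measurable_γ 0)
  have hid := (hZ.ident_γ t).comp hφ
  have h0 : Integrable
      (fun ω => if γmax < γ 0 ω then V * Real.log (1 + S.Pmax * γ 0 ω) else S.B) μ :=
    Integrable.piecewise (s := {ω | γmax < γ 0 ω}) hA (hint.const_mul V).integrableOn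
      (integrable_const S.B).integrableOn
  refine ⟨hid.integrable_iff.2 h0, hid.integral_eq.trans ?_⟩
  simp only [Function.comp_def]
  rw [← integral_add_compl hA h0, ← integral_const_mul,
    setIntegral_congr_fun (f := fun ω => if γmax < γ 0 ω then _ else _) hA
      fun ω hω => if_pos hω,
    setIntegral_congr_fun (f := fun ω => if γmax < γ 0 ω then _ else _) hA.compl
      fun ω hω => if_neg hω,
    setIntegral_const, probReal_compl_eq_one_sub hA, smul_eq_mul]

lemma Admissible.algPower_rate [IsProbabilityMeasure μ] (h : S.Admissible V γmax)
    (hZ : IsStateProcess μ Ea γ)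
    (hint : Integrable (fun ω => Real.log (1 + S.Pmax * γ 0 ω)) μ)
    (hB : S.B ≤ V * Real.log (1 + S.Pmax * γmax)) {Eb0 Ebar0 R : ℝ}
    (hEb0 : Eb0 ∈ Set.Icc S.Emin S.Emax) (hEbar0 : S.Emin ≤ Ebar0)
    (hR : ∀ b, V * R ≤ ∫ ω, S.dualSlot V γmax b (γ 0 ω) (Ea 0 ω) ∂μ) :
    ENNReal.ofReal (R - (1 - μ.real {ω | γmax < γ 0 ω}) * (S.B / V)
        - ∫ ω in {ω | γmax < γ 0 ω}, Real.log (1 + S.Pmax * γ 0 ω) ∂μ)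
      ≤ S.algRate μ V γmax Eb0 Ebar0 Ea γ := by
  have hV := h.V_pos
  set η := μ.real {ω | γmax < γ 0 ω}
  set H := ∫ ω in {ω | γmax < γ 0 ω}, Real.log (1 + S.Pmax * γ 0 ω) ∂μ
  set c := S.refLevel V γmax with hc
  set s : ℕ → Ω → ℝ × ℝ := fun t ω =>
    S.algState V γmax Eb0 Ebar0 (fun τ => Ea τ ω) (fun τ => γ τ ω) t with hs
  set P := S.algPower V γmax Eb0 Ebar0 Ea γ with hPdef
  have hPs : ∀ t ω, P t ω = S.powerAlg V γmax (s t ω).1 (s t ω).2 (γ t ω) := fun _ _ => rfl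
  have hsm : ∀ t, Measurable (s t) := fun t =>
    measurable_algState hZ.measurable_Ea hZ.measurable_γ t
  have hmem : ∀ t ω, (s t ω).1 ∈ Set.Icc S.Emin S.Emax ∧ S.Emin ≤ (s t ω).2 := fun t ω =>
    h.algState_mem hEb0 hEbar0 (fun τ => hZ.Ea_nonneg τ ω) (fun τ => hZ.γ_nonneg τ ω) t
  have hPb : ∀ t, ∀ᵐ ω ∂μ, P t ω ∈ Set.Icc 0 S.Pmax := fun t => Eventually.of_forall fun ω =>
    (h.powerAlg_spec (hZ.γ_nonneg t ω) (hmem t ω).1 (hmem t ω).2).1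
  have hPm : ∀ t, AEMeasurable (P t) μ := fun t =>
    (measurable_algPower hZ.measurable_Ea hZ.measurable_γ t).aemeasurable
  have hM : ∀ t ω, |(s t ω).1 - c| ≤ |S.Emin - c| + |S.Emax - c| := by
    intro t ω
    obtain ⟨h1, h2⟩ := (hmem t ω).1
    rw [abs_le]
    have := neg_abs_le (S.Emin - c)
    have := le_abs_self (S.Emax - c)
    constructor <;> linarith [abs_nonneg (S.Emin - c), abs_nonneg (S.Emax - c)]
  have hdual := fun t => h.integrable_dualSlot hZ hint (hsm t).fst (hM t) t
  have hrate := fun t => hZ.integrable_log hint t (hPm t) (hPb t)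
  have hloss := fun t => integral_loss (S := S) (V := V) (γmax := γmax) hZ hint t
  -- Weak duality at the random battery level, which is independent of the state of slot `t`.
  have hmean : ∀ t, V * R ≤ ∫ ω, S.dualSlot V γmax (s t ω).1 (γ t ω) (Ea t ω) ∂μ := by
    intro t
    refine le_integral_of_indepFun (X := fun ω => (s t ω).1) (Z := fun ω => (Ea t ω, γ t ω))
      (f := fun x : ℝ × ℝ × ℝ => S.dualSlot V γmax x.1 x.2.2 x.2.1) (hsm t).fst
      ((hZ.measurable_Ea t).prodMk (hZ.measurable_γ t)) measurable_dualSlot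
      ((hZ.indepFun_algState Eb0 Ebar0 t).comp measurable_fst measurable_id) (hdual t)
      fun b => (hR b).trans_eq ?_
    exact ((hZ.ident t).comp (measurable_dualSlot.comp
      (measurable_prodMk_left (x := b)))).integral_eq.symm
  set K := (Eb0 - c) ^ 2 / 2 with hK
  have hlim : Tendsto (fun T : ℕ =>
      ENNReal.ofReal (R - (1 - η) * (S.B / V) - H - K / V / T)) atTop
      (𝓝 (ENNReal.ofReal (R - (1 - η) * (S.B / V) - H))) := by
    refine ENNReal.tendsto_ofReal ?_
    simpa using (tendsto_const_nhds (x := R - (1 - η) * (S.B / V) - H)).sub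
      (tendsto_const_div_atTop_nhds_zero_nat (K / V))
  unfold algRate
  rw [← hlim.liminf_eq]
  refine liminf_le_liminf ?_
  filter_upwards [eventually_gt_atTop 0] with T hT
  have hT' : (0 : ℝ) < T := by exact_mod_cast hT
  rw [hZ.avgRate_eq hint hPm hPb hT]
  refine ENNReal.ofReal_le_ofReal ?_
  have hadd : Integrable
      (fun ω => V * ∑ t ∈ Finset.range T, Real.log (1 + P t ω * γ t ω) + K) μ :=
    ((integrable_finsetSum _ fun t _ => hrate t).const_mul V).add (integrable_const K)
  have key : ∫ ω, (∑ t ∈ Finset.range T, S.dualSlot V γmax (s t ω).1 (γ t ω) (Ea t ω)) ∂μ ≤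
      ∫ ω, (V * ∑ t ∈ Finset.range T, Real.log (1 + P t ω * γ t ω) + K
        + ∑ t ∈ Finset.range T,
          if γmax < γ t ω then V * Real.log (1 + S.Pmax * γ t ω) else S.B) ∂μ := by
    refine integral_mono (integrable_finsetSum _ fun t _ => hdual t)
      (hadd.add (integrable_finsetSum _ fun t _ => (hloss t).1)) fun ω => ?_
    have hsum := Finset.sum_le_sum fun t (_ : t ∈ Finset.range T) =>
      h.dualSlot_le (hZ.γ_nonneg t ω) (hZ.Ea_nonneg t ω) (hmem t ω).1 (hmem t ω).2 hB
    rw [Finset.sum_add_distrib, Finset.sum_add_distrib, ← Finset.mul_sum] at hsum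
    have htel : ∑ t ∈ Finset.range T, (((s t ω).1 - c) ^ 2 / 2
        - (S.nextLevel (s t ω).1 (S.powerAlg V γmax (s t ω).1 (s t ω).2 (γ t ω)) (Ea t ω)
          - c) ^ 2 / 2) = ((s 0 ω).1 - c) ^ 2 / 2 - ((s T ω).1 - c) ^ 2 / 2 :=
      Finset.sum_range_sub' (fun t => ((s t ω).1 - c) ^ 2 / 2) T
    have h0 : ((s 0 ω).1 - c) ^ 2 / 2 = K := rfl
    rw [htel, h0] at hsum
    -- The final Lyapunov value is dropped; only the initial one, `K`, remains.
    have := sq_nonneg ((s T ω).1 - c)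
    simp only [hPs]
    linarith
  rw [integral_add hadd (integrable_finsetSum _ fun t _ => (hloss t).1),
    integral_add ((integrable_finsetSum _ fun t _ => hrate t).const_mul V)
      (integrable_const K), integral_const_mul, integral_finsetSum _ fun t _ => hdual t,
    integral_finsetSum _ fun t _ => (hloss t).1] at key
  have hlow := Finset.sum_le_sum fun t (_ : t ∈ Finset.range T) => hmean t
  simp only [fun t => (hloss t).2, Finset.sum_const, Finset.card_range, nsmul_eq_mul,
    integral_const, probReal_univ, one_smul] at key hlow
  rw [le_div_iff₀ hT']
  have : (R - (1 - η) * (S.B / V) - H - K / V / T) * T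
      = (T * (V * R) - T * (V * H + (1 - η) * S.B) - K) / V := by
    field_simp
    ring
  rw [this, div_le_iff₀ hV]
  linarith

/-! ### The outage constant -/

lemma measure_mul_G [IsProbabilityMeasure μ] (γ₀ : Ω → ℝ) :
    μ {ω | γmax < γ₀ ω} * S.G μ γmax γ₀ =
      ∫⁻ ω in {ω | γmax < γ₀ ω}, ENNReal.ofReal (Real.log (1 + S.Pmax * γ₀ ω)) ∂μ := by
  unfold G ProbabilityTheory.cond
  rw [lintegral_smul_measure, smul_eq_mul, ← mul_assoc]
  by_cases h : μ {ω | γmax < γ₀ ω} = 0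
  · rw [Measure.restrict_eq_zero.2 h]
    simp
  · rw [ENNReal.mul_inv_cancel h (measure_ne_top _ _), one_mul]

lemma G_lt_top {γ₀ : Ω → ℝ}
    (hH : ∫⁻ ω, ENNReal.ofReal (Real.log (1 + S.Pmax * γ₀ ω)) ∂μ < ⊤) :
    S.G μ γmax γ₀ < ⊤ := by
  unfold G ProbabilityTheory.cond
  rw [lintegral_smul_measure, smul_eq_mul]
  -- For a null event the normalizing factor is `⊤`, but the integral it multiplies is `0`, and `⊤ *
  -- 0 = 0`.
  by_cases h : μ {ω | γmax < γ₀ ω} = 0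
  · rw [Measure.restrict_eq_zero.2 h]
    simp
  · exact ENNReal.mul_lt_top (ENNReal.inv_lt_top.2 (pos_iff_ne_zero.2 h))
      ((setLIntegral_le_lintegral _ _).trans_lt hH)

lemma le_measure_mul_G [IsProbabilityMeasure μ] (hPmax : 0 ≤ S.Pmax) (hγmax : 0 ≤ γmax)
    {γ₀ : Ω → ℝ} (hm : Measurable γ₀) :
    ENNReal.ofReal (Real.log (1 + S.Pmax * γmax)) * μ {ω | γmax < γ₀ ω} ≤
      μ {ω | γmax < γ₀ ω} * S.G μ γmax γ₀ := by
  rw [measure_mul_G, ← setLIntegral_const]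
  refine setLIntegral_mono (by fun_prop) fun ω hω => ENNReal.ofReal_le_ofReal ?_
  have : S.Pmax * γmax ≤ S.Pmax * γ₀ ω := mul_le_mul_of_nonneg_left (le_of_lt hω) hPmax
  exact Real.log_le_log (by positivity) (by linarith)

/-- Outside an outage the gain is at most `γmax`. This serves both the case of large `B` and the
case of an infinite mean rate, where it forces the outage term to be infinite. -/
lemma lintegral_log_le [IsProbabilityMeasure μ] (hPmax : 0 ≤ S.Pmax) {γ₀ : Ω → ℝ}
    (hm : Measurable γ₀) (h0 : ∀ ω, 0 ≤ γ₀ ω) :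
    ∫⁻ ω, ENNReal.ofReal (Real.log (1 + S.Pmax * γ₀ ω)) ∂μ ≤
      ENNReal.ofReal ((1 - μ.real {ω | γmax < γ₀ ω}) * Real.log (1 + S.Pmax * γmax))
        + μ {ω | γmax < γ₀ ω} * S.G μ γmax γ₀ := by
  have hA : MeasurableSet {ω | γmax < γ₀ ω} := measurableSet_lt measurable_const hm
  rw [← lintegral_add_compl _ hA, measure_mul_G, add_comm]
  gcongr
  rw [← probReal_compl_eq_one_sub hA, mul_comm, ENNReal.ofReal_mul' measureReal_nonneg,
    ofReal_measureReal, ← setLIntegral_const]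
  refine setLIntegral_mono measurable_const fun ω hω => ENNReal.ofReal_le_ofReal ?_
  have hle : γ₀ ω ≤ γmax := not_lt.1 hω
  have h1 := mul_nonneg hPmax (h0 ω)
  have h2 : S.Pmax * γ₀ ω ≤ S.Pmax * γmax := mul_le_mul_of_nonneg_left hle hPmax
  exact Real.log_le_log (by linarith) (by linarith)

end TxSystem

/-! ### Assembly of the bound. -/

theorem theorem2 {Ω : Type*} [mΩ : MeasurableSpace Ω] (μ : Measure Ω) [IsProbabilityMeasure μ]
    -- the transmitter
    (S : TxSystem) (hΔt : 0 < S.Δt) (hPmax : 0 < S.Pmax) (hEc : 0 ≤ S.Ecmax)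
    (hcharge : S.Ecmax ≤ S.Δt * S.Pmax) (hcap : S.Δt * S.Pmax ≤ S.Emax - S.Emin)
    -- energy arrivals and channel gains, i.i.d. over time
    (Ea γ : ℕ → Ω → ℝ)
    (hEa_meas : ∀ t, Measurable (Ea t)) (hγ_meas : ∀ t, Measurable (γ t))
    (hEa : ∀ t ω, 0 ≤ Ea t ω) (hγ : ∀ t ω, 0 ≤ γ t ω)
    (hindep : iIndepFun (fun t ω => (Ea t ω, γ t ω)) μ)
    (hident : ∀ t, IdentDistrib (fun ω => (Ea t ω, γ t ω)) (fun ω => (Ea 0 ω, γ 0 ω)) μ μ)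
    -- the information available to the transmitter, which observes the system state
    (ℱ : Filtration ℕ mΩ) (hobs : ∀ t, Measurable[ℱ t] (fun ω => (Ea t ω, γ t ω)))
    -- outage probability and parameters of the algorithm
    (η γmax V : ℝ) (hγmax : 0 < γmax) (hη : μ.real {ω | γmax < γ 0 ω} = η)
    (hV : 0 < V) (hVmax : V ≤ S.Vmax γmax)
    -- initial battery level, and initial value of the running average
    (Eb0 Ebar0 : ℝ) (hEb0 : Eb0 ∈ Set.Icc S.Emin S.Emax) (hEbar0 : Ebar0 ∈ Set.Icc S.Emin S.Emax) :
    S.optRate μ ℱ Ea γ Eb0 ≤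
        S.algRate μ V γmax Eb0 Ebar0 Ea γ
          + (ENNReal.ofReal ((1 - η) * (S.B / V)) + ENNReal.ofReal η * S.G μ γmax (γ 0))
      ∧ (0 < η → 0 < S.G μ γmax (γ 0))
      ∧ (∫⁻ ω, ENNReal.ofReal (Real.log (1 + S.Pmax * γ 0 ω)) ∂μ < ⊤ →
          S.G μ γmax (γ 0) < ⊤) := by
  have hζ : 0 < S.ζmax γmax := div_pos hγmax hΔt
  have h : S.Admissible V γmax := ⟨hΔt, hPmax, hEc, hcharge, hγmax, hV, (le_div_iff₀ hζ).1 hVmax⟩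
  have hZ : TxSystem.IsStateProcess μ Ea γ := ⟨hEa_meas, hγ_meas, hEa, hγ, hindep, hident⟩
  have hηA : ENNReal.ofReal η = μ {ω | γmax < γ 0 ω} := by
    rw [← hη, ofReal_measureReal]
  have hη1 : 0 ≤ 1 - η := by
    rw [← hη]
    linarith [measureReal_le_one (μ := μ) (s := {ω | γmax < γ 0 ω})]
  have hlog : 0 < Real.log (1 + S.Pmax * γmax) :=
    Real.log_pos (by linarith [mul_pos hPmax hγmax])
  refine ⟨?_, fun hη0 => ?_, TxSystem.G_lt_top⟩
  · rw [hηA]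
    have htriv := (hZ.optRate_le (S := S) (ℱ := ℱ) (Eb0 := Eb0)).trans
      (TxSystem.lintegral_log_le (γmax := γmax) hPmax.le (hγ_meas 0) (hγ 0))
    rw [hη] at htriv
    rcases le_or_gt S.B (V * Real.log (1 + S.Pmax * γmax)) with hB | hB
    · by_cases hH : ∫⁻ ω, ENNReal.ofReal (Real.log (1 + S.Pmax * γ 0 ω)) ∂μ = ⊤
      · have hle := TxSystem.lintegral_log_le (μ := μ) (γmax := γmax) hPmax.le (hγ_meas 0) (hγ 0)
        rw [hH, top_le_iff, ENNReal.add_eq_top] at hle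
        rw [hle.resolve_left ENNReal.ofReal_ne_top]
        simp
      · have hnn : 0 ≤ᵐ[μ] fun ω => Real.log (1 + S.Pmax * γ 0 ω) :=
          Eventually.of_forall fun ω => TxSystem.log_one_add_mul_nonneg hPmax.le (hγ 0 ω)
        have hint : Integrable (fun ω => Real.log (1 + S.Pmax * γ 0 ω)) μ := by
          have := hγ_meas 0
          exact (lintegral_ofReal_ne_top_iff_integrable
            (by fun_prop : AEMeasurable _ μ).aestronglyMeasurable hnn).1 hH
        have hfin : S.optRate μ ℱ Ea γ Eb0 ≠ ⊤ := ne_top_of_le_ne_top hH hZ.optRate_le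
        have halg := h.algPower_rate hZ hint hB hEb0 hEbar0.1
          (h.optRate_le_dual hZ hint (ℱ := ℱ) (Eb0 := Eb0))
        rw [hη] at halg
        rw [TxSystem.measure_mul_G, ← ofReal_integral_eq_lintegral_ofReal hint.integrableOn
          (ae_restrict_of_ae hnn), ← ENNReal.ofReal_toReal hfin]
        set H := ∫ ω in {ω | γmax < γ 0 ω}, Real.log (1 + S.Pmax * γ 0 ω) ∂μ
        set R := (S.optRate μ ℱ Ea γ Eb0).toReal
        -- The lower bound on the algorithm's rate may be negative and is truncated by
        -- `ENNReal.ofReal`, so subadditivity of the truncation replaces subtraction.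
        calc
          ENNReal.ofReal R
              = ENNReal.ofReal ((R - (1 - η) * (S.B / V) - H) + ((1 - η) * (S.B / V) + H)) := by
            congr 1
            ring
          _ ≤ ENNReal.ofReal (R - (1 - η) * (S.B / V) - H)
              + (ENNReal.ofReal ((1 - η) * (S.B / V)) + ENNReal.ofReal H) :=
            ENNReal.ofReal_add_le.trans (by gcongr; exact ENNReal.ofReal_add_le)
          _ ≤ _ := by gcongr
    -- Here `log(1 + Pmax γmax) < B / V`, so the full-power bound suffices and the algorithm's rate
    -- is not needed.
    · refine (htriv.trans ?_).trans le_add_self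
      gcongr
      rw [le_div_iff₀ hV]
      linarith
  · rw [← hη] at hη0
    have hA : μ {ω | γmax < γ 0 ω} ≠ 0 := fun hA => by simp [measureReal_def, hA] at hη0
    have hle := TxSystem.le_measure_mul_G (S := S) (μ := μ) hPmax.le hγmax.le (hγ_meas 0)
    have hpos : 0 < ENNReal.ofReal (Real.log (1 + S.Pmax * γmax)) * μ {ω | γmax < γ 0 ω} :=
      ENNReal.mul_pos (ENNReal.ofReal_pos.2 hlog).ne' hA
    exact pos_iff_ne_zero.2 (right_ne_zero_of_mul (hpos.trans_le hle).ne')
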